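/- Conventions. Let $n\in\mathbb N$, let $\Omega\subseteq\mathbb R^n$ be open and let $K\subseteq\Omega$ be compact. Let $\mathcal D_K(\Omega)$ be the vector space of all $\varphi\in\mathcal C^\infty(\Omega,\mathbb R)$ with $\operatorname{supp}\varphi\subseteq K$, with its Fréchet topology, given by the norms $\max_{|\alpha|\le m}\max_{x\in K}|\partial^\alpha\varphi(x)|$, $m\in\mathbb N$. A diffeology on a set $X$ is a family of maps $U\to X$ (the plots), for all open subsets $U$ of all Euclidean spaces $\mathbb R^m$, that contains the constant maps and is stable under precomposition with smooth maps $V\to U$ and under gluing along open coverings; a map between diffeological spaces is smooth if it sends plots to plots. An open $U\subseteq\mathbb R^m$ carries the standard diffeology, whose plots are the ordinary $\mathcal C^\infty$ maps into $U$. The canonical diffeology of a topological vector space $V$ has as plots the maps $d:U\to V$ such that $l\circ d\in\mathcal C^\infty(U,\mathbb R)$ for every continuous linear $l:V\to\mathbb R$; $\mathcal D_K(\Omega)$ carries this diffeology. The functional diffeology of $\mathcal C^\infty(\Omega,\mathbb R)$ has as plots the maps $d:U\to\mathcal C^\infty(\Omega,\mathbb R)$ such that $d^\vee\in\mathcal C^\infty(U\times\Omega,\mathbb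 R)$, where $d^\vee(u,x)=d(u)(x)$. Write $\mathcal D^{s}_K(\Omega)$ for the set $\mathcal D_K(\Omega)$ with the sub-diffeology from $\mathcal C^\infty(\Omega,\mathbb R)$: its plots are the maps into $\mathcal D_K(\Omega)$ that are plots of $\mathcal C^\infty(\Omega,\mathbb R)$. Theorem. 1. Let $U\subseteq\mathbb R^m$ be open, $m\in\mathbb N$. For every map $f:U\to\mathcal D_K(\Omega)$ the following are equivalent: (a) $f$ is a plot of the canonical diffeology of $\mathcal D_K(\Omega)$; (b) $f$ is a smooth map of diffeological spaces from $U$ to $\mathcal D_K(\Omega)$; (c) $f^\vee\in\mathcal C^\infty(U\times\Omega,\mathbb R)$ and $\operatorname{supp} f^\vee(u,-)\subseteq K$ for all $u\in U$. 2. More precisely, let $g:U\times\Omega\to\mathbb R$ be an arbitrary function. Then $u\mapsto g(u,-)$ takes values in $\mathcal D_K(\Omega)$ and is a smooth map of diffeological spaces $U\to\mathcal D_K(\Omega)$ if and only if $g\in\mathcal C^\infty(U\times\Omega,\mathbb R)$ and $\operatorname{supp} g(u,-)\subseteq K$ for all $u\in U$. 3. Hence $\mathcal D_K(\Omega)=\mathcal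 D^{s}_K(\Omega)$ as diffeological spaces. -/

import Mathlib

open scoped ContDiff Topology Distributions
open TopologicalSpace

noncomputable section

namespace FigDiffeo

/-- The Euclidean space `ℝᵐ`. -/
abbrev Eucl (m : ℕ) : Type := EuclideanSpace ℝ (Fin m)

/-- `f : U → F`, defined on an open set `U`, is of class `C^∞` on `U` in the ordinary sense.
(The values of the extension outside `U` play no role.) -/
def IsSmooth {E F : Type*} [NormedAddCommGroup E] [NormedSpace ℝ E]
    [NormedAddCommGroup F] [NormedSpace ℝ F] {U : Opens E} (f : U → F) : Prop :=
  ContDiffOn ℝ ∞ (Function.extend (Subtype.val : U → E) f 0) (U : Set E)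

section Smooth

theorem extend_val {E F : Type*} [TopologicalSpace E] [Zero F] {U : Opens E} (f : U → F) {x : E} (hx : x ∈ U) :
    Function.extend (Subtype.val : U → E) f 0 x = f ⟨x, hx⟩ :=
  Subtype.val_injective.extend_apply f 0 ⟨x, hx⟩

variable {E F G : Type*} [NormedAddCommGroup E] [NormedSpace ℝ E]
  [NormedAddCommGroup F] [NormedSpace ℝ F] [NormedAddCommGroup G] [NormedSpace ℝ G]

theorem isSmooth_of_contDiffOn {U : Opens E} {f : U → F} {g : E → F}
    (hg : ContDiffOn ℝ ∞ g (U : Set E)) (h : ∀ x : U, f x = g x) : IsSmooth f :=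
  hg.congr fun x hx => by rw [extend_val f hx]; exact h ⟨x, hx⟩

theorem IsSmooth.comp {V : Opens E} {U : Opens F} {f : U → G} (hf : IsSmooth f)
    {g : V → U} (hg : IsSmooth fun v => (g v : F)) : IsSmooth (f ∘ g) := by
  refine isSmooth_of_contDiffOn (ContDiffOn.comp (s := (V : Set E)) (t := (U : Set F)) hf hg ?_) ?_
  · intro x hx
    rw [extend_val _ hx]
    exact (g ⟨x, hx⟩).2
  · intro x
    simp only [Function.comp_apply]
    rw [extend_val (fun v => (g v : F)) x.2, extend_val f (g ⟨x, x.2⟩).2]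

theorem isSmooth_of_locally {U : Opens E} {f : U → F}
    (h : ∀ x : U, ∃ (W : Opens E) (hW : W ≤ U), (x : E) ∈ W ∧
      IsSmooth (fun w : W => f ⟨w, hW w.2⟩)) : IsSmooth f := by
  intro x hx
  obtain ⟨W, hW, hxW, hs⟩ := h ⟨x, hx⟩
  have h1 : ContDiffOn ℝ ∞ (Function.extend (Subtype.val : U → E) f 0) (W : Set E) :=
    ContDiffOn.congr hs fun y hy => by rw [extend_val f (hW hy), extend_val _ hy]
  exact (h1.contDiffAt (W.isOpen.mem_nhds hxW)).contDiffWithinAt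

/-- The product `U × Ω` of two open sets. -/
def prodOpens (U : Opens E) (Ω : Opens F) : Opens (E × F) :=
  ⟨(U : Set E) ×ˢ (Ω : Set F), U.isOpen.prod Ω.isOpen⟩

/-- For `f : U → (Ω → G)`, the map `f^∨ : U × Ω → G`, `(u, x) ↦ f(u)(x)`. -/
def vee {U : Opens E} {Ω : Opens F} (f : U → Ω → G) : (prodOpens U Ω) → G :=
  fun p => f ⟨p.1.1, p.2.1⟩ ⟨p.1.2, p.2.2⟩

end Smooth

/-- A diffeology on the set `X`: a family of maps `U → X` (the plots, or figures of type `U`), for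
all open sets `U` of all Euclidean spaces `ℝᵐ`, that contains the constant maps and is stable under
smooth reparametrization and under gluing along open coverings of `U`. -/
@[ext]
structure FigDiffeology (X : Type*) where
  /-- `d : U → X` is a plot. -/
  IsPlot : ∀ {m : ℕ} {U : Opens (Eucl m)}, (U → X) → Prop
  const : ∀ {m : ℕ} {U : Opens (Eucl m)} (x : X), IsPlot (fun _ : U => x)
  reparam : ∀ {m k : ℕ} {U : Opens (Eucl m)} {V : Opens (Eucl k)} {d : U → X} (g : V → U),
    IsPlot d → IsSmooth (fun v => (g v : Eucl m)) → IsPlot (d ∘ g)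
  sheaf : ∀ {m : ℕ} {U : Opens (Eucl m)} {d : U → X},
    (∀ u : U, ∃ (W : Opens (Eucl m)) (hW : W ≤ U), (u : Eucl m) ∈ W ∧
      IsPlot (fun w : W => d ⟨w, hW w.2⟩)) → IsPlot d

/-- Smooth maps between diffeological spaces, i.e. elements of `C^∞(X, Y)`. -/
def DiffSmooth {X Y : Type*} (DX : FigDiffeology X) (DY : FigDiffeology Y) (f : X → Y) : Prop :=
  ∀ {m : ℕ} {U : Opens (Eucl m)} (d : U → X), DX.IsPlot d → DY.IsPlot (f ∘ d)

/-- The standard diffeology of an open subset `U` of a Euclidean space. -/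
def standardDiffeology {m : ℕ} (U : Opens (Eucl m)) : FigDiffeology U where
  IsPlot d := IsSmooth fun v => (d v : Eucl m)
  const x := isSmooth_of_contDiffOn (g := fun _ => (x : Eucl m)) contDiffOn_const fun _ => rfl
  reparam _ hd hg := IsSmooth.comp hd hg
  sheaf h := isSmooth_of_locally h

/-- The canonical diffeology of a topological vector space: plots are the maps that become smooth
when tested by continuous linear functionals. -/
def canonicalDiffeology (V : Type*) [AddCommGroup V] [Module ℝ V] [TopologicalSpace V]
    [IsTopologicalAddGroup V] [ContinuousSMul ℝ V] : FigDiffeology V where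
  IsPlot d := ∀ l : V →L[ℝ] ℝ, IsSmooth fun u => l (d u)
  const x l := isSmooth_of_contDiffOn (g := fun _ => l x) contDiffOn_const fun _ => rfl
  reparam _ hd hg l := IsSmooth.comp (hd l) hg
  sheaf h l := isSmooth_of_locally fun u =>
    let ⟨W, hW, hu, hp⟩ := h u
    ⟨W, hW, hu, hp l⟩

/-- The sub-diffeology on a subset `A` of the diffeological space `Y`. -/
def subDiffeology {Y : Type*} (DY : FigDiffeology Y) (A : Set Y) : FigDiffeology A where
  IsPlot d := DY.IsPlot fun u => (d u : Y)
  const x := DY.const (x : Y)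
  reparam g hd hg := DY.reparam g hd hg
  sheaf h := DY.sheaf h

section TestFunctions

variable {n : ℕ}

/-- The real vector space `C^∞(Ω, ℝ)`. -/
def SmoothFun (Ω : Opens (Eucl n)) : Submodule ℝ (Ω → ℝ) where
  carrier := {f | IsSmooth f}
  add_mem' {f g} hf hg := isSmooth_of_contDiffOn (ContDiffOn.add hf hg) fun x => by
    simp only [Pi.add_apply]
    rw [extend_val f x.2, extend_val g x.2]
  zero_mem' := isSmooth_of_contDiffOn (g := fun _ => 0) contDiffOn_const fun _ => rfl
  smul_mem' c f hf := isSmooth_of_contDiffOn (ContDiffOn.const_smul c hf) fun x => by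
    simp only [Pi.smul_apply]
    rw [extend_val f x.2]

/-- The functional diffeology of `C^∞(Ω, ℝ)`: `d` is a plot iff `d^∨ ∈ C^∞(U × Ω, ℝ)`. -/
def functionalDiffeology (Ω : Opens (Eucl n)) : FigDiffeology (SmoothFun Ω) where
  IsPlot d := IsSmooth (vee fun u => (d u : Ω → ℝ))
  const {m U} f := by
    refine isSmooth_of_contDiffOn
      (g := fun p : Eucl m × Eucl n => Function.extend Subtype.val (f : Ω → ℝ) 0 p.2) ?_ ?_
    · exact ContDiffOn.comp (t := (Ω : Set (Eucl n))) f.2 contDiffOn_snd fun p hp => hp.2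
    · intro p
      rw [extend_val (f : Ω → ℝ) p.2.2]
      rfl
  reparam {m k U V d} g hd hg := by
    have h2 : IsSmooth (U := prodOpens V Ω) (fun p => ((g ⟨p.1.1, p.2.1⟩ : Eucl m), p.1.2)) := by
      refine isSmooth_of_contDiffOn
        (g := fun p : Eucl k × Eucl n =>
          (Function.extend Subtype.val (fun v => (g v : Eucl m)) 0 p.1, p.2)) ?_ ?_
      · exact ContDiffOn.prodMk
          (ContDiffOn.comp (t := (V : Set (Eucl k))) hg contDiffOn_fst fun p hp => hp.1)
          contDiffOn_snd
      · intro p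
        rw [extend_val (fun v => (g v : Eucl m)) p.2.1]
    exact IsSmooth.comp (V := prodOpens V Ω) (U := prodOpens U Ω) hd
      (g := fun p => ⟨((g ⟨p.1.1, p.2.1⟩ : Eucl m), p.1.2), ⟨(g ⟨p.1.1, p.2.1⟩).2, p.2.2⟩⟩) h2
  sheaf {m U d} h := isSmooth_of_locally fun p => by
    obtain ⟨W, hW, hu, hp⟩ := h ⟨p.1.1, p.2.1⟩
    exact ⟨prodOpens W Ω, fun q hq => ⟨hW hq.1, hq.2⟩, ⟨hu, p.2.2⟩, hp⟩

/-- `𝒟_K(Ω)`: the functions in `C^∞(Ω, ℝ)` whose support is contained in the compact subset `K`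
of `Ω`. -/
def DK (Ω : Opens (Eucl n)) (K : Compacts Ω) : Submodule ℝ (SmoothFun Ω) where
  carrier := {f | tsupport (f : Ω → ℝ) ⊆ (K : Set Ω)}
  add_mem' {f g} hf hg := (tsupport_add (f : Ω → ℝ) (g : Ω → ℝ)).trans (Set.union_subset hf hg)
  zero_mem' := by simp [tsupport]
  smul_mem' c f hf :=
    (closure_mono (Function.support_const_smul_subset c (f : Ω → ℝ))).trans hf

/-- A compact subset of `Ω`, as a compact subset of `ℝⁿ`. -/
def ambient {Ω : Opens (Eucl n)} (K : Compacts Ω) : Compacts (Eucl n) :=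
  K.map Subtype.val continuous_subtype_val

theorem extend_eq_zero {Ω : Opens (Eucl n)} {K : Compacts Ω} (φ : DK Ω K) {x : Eucl n}
    (hx : x ∉ ambient K) : Function.extend Subtype.val (φ.1 : Ω → ℝ) 0 x = 0 := by
  by_cases h : x ∈ Ω
  · rw [extend_val _ h]
    by_contra hne
    exact hx ⟨⟨x, h⟩, φ.2 (subset_tsupport _ hne), rfl⟩
  · rw [Function.extend_apply' _ _ _ (by rintro ⟨y, rfl⟩; exact h y.2)]
    rfl

/-- Extension by zero identifies `𝒟_K(Ω)` with the space of smooth functions on `ℝⁿ` that vanish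
outside `K`. -/
def extendByZero (Ω : Opens (Eucl n)) (K : Compacts Ω) :
    DK Ω K →ₗ[ℝ] 𝓓_{ambient K}(Eucl n, ℝ) where
  toFun φ :=
    { toFun := Function.extend Subtype.val (φ.1 : Ω → ℝ) 0
      contDiff' := contDiff_iff_contDiffAt.2 fun x => by
        by_cases hx : x ∈ ambient K
        · have hxΩ : x ∈ Ω := by
            obtain ⟨y, -, rfl⟩ := hx
            exact y.2
          exact ContDiffOn.contDiffAt φ.1.2 (Ω.isOpen.mem_nhds hxΩ)
        · refine (contDiffAt_const (c := (0 : ℝ))).congr_of_eventuallyEq ?_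
          filter_upwards [(ambient K).isCompact.isClosed.isOpen_compl.mem_nhds hx] with y hy
          exact extend_eq_zero φ hy
      zero_on_compl' := fun _ hx => extend_eq_zero φ hx }
  map_add' φ ψ := by
    ext x
    change Function.extend Subtype.val ((φ + ψ).1 : Ω → ℝ) 0 x =
      Function.extend Subtype.val (φ.1 : Ω → ℝ) 0 x + Function.extend Subtype.val (ψ.1 : Ω → ℝ) 0 x
    by_cases h : x ∈ Ω
    · simp only [extend_val _ h]
      rfl
    · have h' : ¬ ∃ y : Ω, (y : Eucl n) = x := by rintro ⟨y, rfl⟩; exact h y.2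
      simp only [Function.extend_apply' _ _ _ h', Pi.zero_apply, add_zero]
  map_smul' c φ := by
    ext x
    change Function.extend Subtype.val ((c • φ).1 : Ω → ℝ) 0 x =
      c • Function.extend Subtype.val (φ.1 : Ω → ℝ) 0 x
    by_cases h : x ∈ Ω
    · simp only [extend_val _ h]
      rfl
    · have h' : ¬ ∃ y : Ω, (y : Eucl n) = x := by rintro ⟨y, rfl⟩; exact h y.2
      simp only [Function.extend_apply' _ _ _ h', Pi.zero_apply, smul_zero]

/-- The Fréchet topology of `𝒟_K(Ω)`: uniform convergence on `K` of all derivatives, i.e. the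
topology given by the norms `max_{|α| ≤ m} max_{x ∈ K} |∂^α φ(x)|`, `m ∈ ℕ`. (Not an instance,
since the subtype `DK Ω K` of `Ω → ℝ` also carries the topology of pointwise convergence.) -/
abbrev frechetTopology (Ω : Opens (Eucl n)) (K : Compacts Ω) : TopologicalSpace (DK Ω K) :=
  TopologicalSpace.induced (extendByZero Ω K)
    (ContDiffMapSupportedIn.topologicalSpace (E := Eucl n) (F := ℝ) (n := ⊤) (K := ambient K))

theorem isTopologicalAddGroup_frechet (Ω : Opens (Eucl n)) (K : Compacts Ω) :
    @IsTopologicalAddGroup (DK Ω K) (frechetTopology Ω K) _ :=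
  topologicalAddGroup_induced (extendByZero Ω K)

theorem continuousSMul_frechet (Ω : Opens (Eucl n)) (K : Compacts Ω) :
    @ContinuousSMul ℝ (DK Ω K) _ _ (frechetTopology Ω K) :=
  continuousSMul_induced (extendByZero Ω K)

/-- The canonical diffeology of the locally convex space `𝒟_K(Ω)`. -/
def diffeologyDK (Ω : Opens (Eucl n)) (K : Compacts Ω) : FigDiffeology (DK Ω K) :=
  @canonicalDiffeology (DK Ω K) _ _ (frechetTopology Ω K)
    (isTopologicalAddGroup_frechet Ω K) (continuousSMul_frechet Ω K)

/-- `𝒟ˢ_K(Ω)`: the set `𝒟_K(Ω)` with the sub-diffeology from `C^∞(Ω, ℝ)`. -/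
def subDiffeologyDK (Ω : Opens (Eucl n)) (K : Compacts Ω) : FigDiffeology (DK Ω K) :=
  subDiffeology (functionalDiffeology Ω) (DK Ω K : Set (SmoothFun Ω))

end TestFunctions

end FigDiffeo

end

open FigDiffeo

/-! Everything reduces to one equivalence: `f` is a plot of the canonical diffeology iff `f^∨` is
smooth. Extension by zero replaces `Ω` by the whole space `ℝⁿ`.

Weak implies joint. `𝓓_K` embeds in a product of Banach spaces, one for each order of derivative. In
each factor, scalar Taylor estimates for all functionals become norm estimates by uniform
boundedness, so a weakly smooth `f` is continuous and its difference quotients are Cauchy. The image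
of `𝓓_K` being closed, the limits are test functions, and they again form weakly smooth maps
(`WeaklySmoothOn.exists_deriv_map`). So the functions `f^∨` with `f` weakly smooth are
differentiable and stable under directional derivatives, hence smooth
(`contDiffOn_infty_of_stable`).

Joint implies weak. A continuous functional is bounded by finitely many sup norms of derivatives, so
by Hahn–Banach it factors through finitely many spaces of continuous functions on `K`
(`exists_factorization`). Into these, `u ↦ D^i f(u)` is smooth, because compactness of `K` makes the
difference quotients converge uniformly. -/

namespace FigDiffeo

open Set Filter Function


/-! ### Weak smoothness in normed spaces, and completeness of `𝓓_K` -/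

section General

variable {E F X : Type*} [NormedAddCommGroup E] [NormedSpace ℝ E]
  [NormedAddCommGroup F] [NormedSpace ℝ F] [NormedAddCommGroup X] [NormedSpace ℝ X]

/-- If a class of maps consists of differentiable maps and is stable under directional derivatives,
then its members are smooth. -/
theorem contDiffOn_infty_of_stable [FiniteDimensional ℝ E] {s : Set E} (hs : IsOpen s)
    {P : (E → F) → Prop} (hd : ∀ g, P g → DifferentiableOn ℝ g s)
    (hP : ∀ g, P g → ∀ v, P fun x => fderiv ℝ g x v) {g : E → F} (hg : P g) :
    ContDiffOn ℝ ∞ g s := by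
  rw [contDiffOn_infty]
  intro k
  induction k generalizing g with
  | zero => exact contDiffOn_zero.2 (hd g hg).continuousOn
  | succ k ih =>
    rw [Nat.cast_succ, contDiffOn_succ_iff_fderiv_of_isOpen hs]
    -- In finite dimension `fderiv` may be tested on one vector at a time; the clause about
    -- analyticity is vacuous at finite order.
    exact ⟨hd g hg, fun h => by simp at h, contDiffOn_clm_apply.2 fun v => ih (hP g hg v)⟩

/-- A weakly bounded family in a normed space is bounded. -/
theorem exists_norm_le_of_weakly_bounded {ι : Type*} {x : ι → X}
    (h : ∀ l : X →L[ℝ] ℝ, ∃ C, ∀ i, ‖l (x i)‖ ≤ C) : ∃ C, ∀ i, ‖x i‖ ≤ C := by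
  -- The points act as operators on the dual, which is complete even when `X` is not.
  obtain ⟨C, hC⟩ := banach_steinhaus (g := fun i => NormedSpace.inclusionInDoubleDualLi ℝ (x i)) h
  exact ⟨C, fun i =>
    ((NormedSpace.inclusionInDoubleDualLi (E := X) ℝ).norm_map (x i)).symm.trans_le (hC i)⟩

/-- The mean value inequality is used twice. `C` bounds the second derivative on the compact ball,
so `fderiv ℝ φ` moves by at most `C * ‖v - u‖` on the ball of radius `‖v - u‖`. -/
theorem exists_taylor_bound {φ : E → F} {U : Set E} [ProperSpace E] (hφ : ContDiffOn ℝ ∞ φ U)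
    {u : E} {r : ℝ} (hU : IsOpen U) (hr : Metric.closedBall u r ⊆ U) :
    ∃ C, ∀ v ∈ Metric.closedBall u r, ‖φ v - φ u - fderiv ℝ φ u (v - u)‖ ≤ C * ‖v - u‖ ^ 2 := by
  have h1 : ContDiffOn ℝ ∞ (fderiv ℝ φ) U := hφ.fderiv_of_isOpen hU (by simp)
  have h2 : ContDiffOn ℝ ∞ (fderiv ℝ (fderiv ℝ φ)) U := h1.fderiv_of_isOpen hU (by simp)
  obtain ⟨C, hC⟩ := (isCompact_closedBall u r).exists_bound_of_continuousOn
    (E := E →L[ℝ] E →L[ℝ] F) (h2.continuousOn.mono hr)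
  have hd : ∀ v ∈ Metric.closedBall u r, DifferentiableAt ℝ φ v :=
    fun v hv => (hφ.contDiffAt (hU.mem_nhds (hr hv))).differentiableAt (by simp)
  have hd1 : ∀ v ∈ Metric.closedBall u r, DifferentiableAt ℝ (fderiv ℝ φ) v :=
    fun v hv => (h1.contDiffAt (hU.mem_nhds (hr hv))).differentiableAt (by simp)
  refine ⟨C, fun v hv => ?_⟩
  have hvr : ‖v - u‖ ≤ r := by simpa [dist_eq_norm] using hv
  have hsub : Metric.closedBall u ‖v - u‖ ⊆ Metric.closedBall u r :=
    Metric.closedBall_subset_closedBall hvr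
  have hu : u ∈ Metric.closedBall u ‖v - u‖ := by simp
  have hv' : v ∈ Metric.closedBall u ‖v - u‖ := by simp [dist_eq_norm]
  have hC0 : 0 ≤ C := (norm_nonneg _).trans (hC u (hsub hu))
  have := (convex_closedBall u ‖v - u‖).norm_image_sub_le_of_norm_fderiv_le' (𝕜 := ℝ)
    (φ := fderiv ℝ φ u) (C := C * ‖v - u‖) (fun w hw => hd w (hsub hw))
    (fun w hw => by
      refine ((convex_closedBall u ‖v - u‖).norm_image_sub_le_of_norm_fderiv_le (𝕜 := ℝ)
        (fun w hw => hd1 w (hsub hw)) (fun w hw => hC w (hsub hw)) hu hw).trans ?_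
      gcongr
      simpa [dist_eq_norm] using hw) hu hv'
  linarith [this]

/-- A weakly smooth map into a normed space is continuous. -/
theorem continuousAt_of_weakly_contDiffOn [ProperSpace E] {f : E → X} {U : Set E} (hU : IsOpen U)
    (hf : ∀ l : X →L[ℝ] ℝ, ContDiffOn ℝ ∞ (fun u => l (f u)) U) {u : E} (hu : u ∈ U) :
    ContinuousAt f u := by
  obtain ⟨r, hr, hrU⟩ := Metric.nhds_basis_closedBall.mem_iff.1 (hU.mem_nhds hu)
  -- The normalised increments are weakly bounded by Taylor, so `f` satisfies a Lipschitz estimate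
  -- at `u`. At `v = u` the entry is `0`, since `0⁻¹ = 0`.
  obtain ⟨C, hC⟩ := exists_norm_le_of_weakly_bounded
    (x := fun v : Metric.closedBall u r => ‖(v : E) - u‖⁻¹ • (f v - f u)) (fun l => by
      obtain ⟨C, hC⟩ := exists_taylor_bound (hf l) hU hrU
      refine ⟨|C| * r + ‖fderiv ℝ (fun u => l (f u)) u‖, fun v => ?_⟩
      have hvr : ‖(v : E) - u‖ ≤ r := mem_closedBall_iff_norm.1 v.2
      rw [map_smul, map_sub, norm_smul, norm_inv, norm_norm]
      rcases eq_or_ne ((v : E) - u) 0 with h0 | h0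
      · rw [h0]; simp; positivity
      rw [inv_mul_le_iff₀ (by positivity)]
      calc ‖l (f v) - l (f u)‖
          = ‖(l (f v) - l (f u) - fderiv ℝ (fun u => l (f u)) u (v - u)) +
            fderiv ℝ (fun u => l (f u)) u (v - u)‖ := by rw [sub_add_cancel]
        _ ≤ |C| * ‖(v : E) - u‖ ^ 2 + ‖fderiv ℝ (fun u => l (f u)) u‖ * ‖(v : E) - u‖ := by
            refine (norm_add_le _ _).trans (add_le_add ((hC v v.2).trans ?_)
              (ContinuousLinearMap.le_opNorm _ _))
            gcongr
            exact le_abs_self C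
        _ ≤ ‖(v : E) - u‖ * (|C| * r + ‖fderiv ℝ (fun u => l (f u)) u‖) := by
            have : |C| * ‖(v : E) - u‖ ^ 2 ≤ |C| * (‖(v : E) - u‖ * r) := by
              rw [sq]; gcongr
            linarith)
  have hb : ∀ᶠ v in 𝓝 u, ‖f v - f u‖ ≤ C * ‖v - u‖ := by
    filter_upwards [Metric.closedBall_mem_nhds u hr] with v hv
    rcases eq_or_ne (v - u) 0 with h0 | h0
    · rw [sub_eq_zero.1 h0]; simp
    have := hC ⟨v, hv⟩
    rw [norm_smul, norm_inv, norm_norm, inv_mul_le_iff₀ (by positivity)] at this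
    linarith
  rw [ContinuousAt, tendsto_iff_norm_sub_tendsto_zero]
  refine squeeze_zero' (Eventually.of_forall fun _ => norm_nonneg _) hb ?_
  have : Continuous fun v : E => C * ‖v - u‖ := by fun_prop
  simpa using this.tendsto u

/-- The difference quotients of a weakly smooth map into a Banach space converge in norm. -/
theorem exists_tendsto_slope_of_weakly_contDiffOn [ProperSpace E] [CompleteSpace X] {f : E → X}
    {U : Set E} (hU : IsOpen U)
    (hf : ∀ l : X →L[ℝ] ℝ, ContDiffOn ℝ ∞ (fun u => l (f u)) U) {u : E} (hu : u ∈ U) (h : E) :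
    ∃ a, Tendsto (fun t : ℝ => t⁻¹ • (f (u + t • h) - f u)) (𝓝[≠] 0) (𝓝 a) := by
  obtain ⟨r, hr, hrU⟩ := Metric.nhds_basis_closedBall.mem_iff.1 (hU.mem_nhds hu)
  have hT : {t : ℝ | t ≠ 0 ∧ u + t • h ∈ Metric.closedBall u r} ∈ 𝓝[≠] (0 : ℝ) := by
    have hc : Continuous fun t : ℝ => u + t • h := by fun_prop
    refine inter_mem self_mem_nhdsWithin (mem_nhdsWithin_of_mem_nhds
      (hc.continuousAt.preimage_mem_nhds (t := Metric.closedBall u r) ?_))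
    simpa using Metric.closedBall_mem_nhds u hr
  set T := {t : ℝ | t ≠ 0 ∧ u + t • h ∈ Metric.closedBall u r}
  set q : ℝ → X := fun t => t⁻¹ • (f (u + t • h) - f u)
  -- By Taylor, `l (q t)` is within `O(|t|)` of the directional derivative. Dividing `q s - q t` by
  -- `|s| + |t|` thus leaves a weakly bounded family, and its norm bound makes `q` Cauchy at `0`.
  obtain ⟨C, hC⟩ := exists_norm_le_of_weakly_bounded
    (x := fun p : T × T => (|(p.1 : ℝ)| + |(p.2 : ℝ)|)⁻¹ • (q p.1 - q p.2)) (fun l => by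
      obtain ⟨C, hC⟩ := exists_taylor_bound (hf l) hU hrU
      set a := fderiv ℝ (fun u => l (f u)) u h
      have hq : ∀ t ∈ T, ‖l (q t) - a‖ ≤ C * ‖h‖ ^ 2 * |t| := by
        intro t ht
        have := hC _ ht.2
        rw [add_sub_cancel_left, map_smul, norm_smul] at this
        have h2 : l (q t) - a = t⁻¹ • (l (f (u + t • h)) - l (f u) - t • a) := by
          simp only [q, map_smul, map_sub, smul_sub, smul_smul, inv_mul_cancel₀ ht.1, one_smul]
        rw [h2, norm_smul, norm_inv, inv_mul_le_iff₀ (norm_pos_iff.2 ht.1)]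
        refine this.trans (le_of_eq ?_)
        rw [Real.norm_eq_abs]; ring
      refine ⟨C * ‖h‖ ^ 2, fun p => ?_⟩
      have h1 : 0 < |(p.1 : ℝ)| + |(p.2 : ℝ)| := by
        have := abs_pos.2 p.1.2.1
        positivity
      rw [map_smul, norm_smul, norm_inv, Real.norm_of_nonneg h1.le, inv_mul_le_iff₀ h1, map_sub]
      calc ‖l (q p.1) - l (q p.2)‖ ≤ ‖l (q p.1) - a‖ + ‖l (q p.2) - a‖ := by
            simpa using norm_sub_le (l (q p.1) - a) (l (q p.2) - a)
        _ ≤ _ := add_le_add (hq _ p.1.2) (hq _ p.2.2)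
        _ = _ := by ring)
  refine cauchy_map_iff_exists_tendsto.1 (cauchy_map_iff.2 ⟨inferInstance, ?_⟩)
  rw [tendsto_uniformity_iff_dist_tendsto_zero]
  refine squeeze_zero' (Eventually.of_forall fun _ => dist_nonneg)
    (g := fun p : ℝ × ℝ => C * (|p.1| + |p.2|)) ?_ ?_
  · filter_upwards [prod_mem_prod hT hT] with p hp
    have h1 : 0 < |p.1| + |p.2| := by
      have := abs_pos.2 hp.1.1
      positivity
    have := hC (⟨p.1, hp.1⟩, ⟨p.2, hp.2⟩)
    rw [norm_smul, norm_inv, Real.norm_of_nonneg h1.le, inv_mul_le_iff₀ h1] at this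
    rw [dist_eq_norm]
    exact this.trans (le_of_eq (mul_comm _ _))
  · have hc : Continuous fun p : ℝ × ℝ => C * (|p.1| + |p.2|) := by fun_prop
    have := hc.tendsto 0
    simp only [Prod.fst_zero, abs_zero, Prod.snd_zero, add_zero, mul_zero] at this
    refine this.mono_left ?_
    rw [Prod.zero_eq_mk, nhds_prod_eq]
    exact Filter.prod_mono nhdsWithin_le_nhds nhdsWithin_le_nhds

/-- Test functions with fixed support form a complete space: the families of derivatives of test
functions are closed under uniform convergence. -/
theorem isClosed_range_pi_structureMapCLM (K : Compacts E) :
    IsClosed (range (ContinuousLinearMap.pi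
      (ContDiffMapSupportedIn.structureMapCLM ℝ (E := E) (F := F) (K := K) ⊤))) := by
  have hev : ∀ (i : ℕ) (x : E), Continuous
      fun p : (∀ i : ℕ, BoundedContinuousFunction E (E [×i]→L[ℝ] F)) => p i x := fun i x =>
    (continuous_eval_const x).comp (continuous_apply i)
  rw [isClosed_iff_forall_filter]
  intro p l hl hlr hlp
  have hlim : ∀ i, Tendsto (fun q : (∀ i : ℕ, BoundedContinuousFunction E (E [×i]→L[ℝ] F)) => q i) l
      (𝓝 (p i)) := fun i => ((continuous_apply i).tendsto p).mono_left hlp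
  have hlimx : ∀ i x,
      Tendsto (fun q : (∀ i : ℕ, BoundedContinuousFunction E (E [×i]→L[ℝ] F)) => q i x) l
      (𝓝 (p i x)) := fun i x => ((hev i x).tendsto p).mono_left hlp
  -- Derivatives pass to the limit because the next order converges uniformly; currying is an
  -- isometry and preserves this.
  have hder : ∀ (i : ℕ) (x : E), HasFDerivAt (p i) (p (i + 1) x).curryLeft x := by
    intro i x
    refine hasFDerivAt_of_tendstoUniformlyOnFilter (l := l)
      (f := fun q x => q i x) (f' := fun q x => (q (i + 1) x).curryLeft)
      (g' := fun x => (p (i + 1) x).curryLeft) ?_ ?_ (Eventually.of_forall fun y => hlimx i y)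
    · have h1 := BoundedContinuousFunction.tendsto_iff_tendstoUniformly.1 (hlim (i + 1))
      have h2 := (continuousMultilinearCurryLeftEquiv ℝ (fun _ : Fin (i + 1) => E)
        F).isometry.uniformContinuous.comp_tendstoUniformly h1
      exact (h2.tendstoUniformlyOn (s := univ)).tendstoUniformlyOnFilter.mono_right (by simp)
    · have h3 : ∀ᶠ q in l, ∀ y, HasFDerivAt (q i) (q (i + 1) y).curryLeft y := by
        filter_upwards [le_principal_iff.1 hlr]
        rintro _ ⟨φ, rfl⟩ y
        simp only [ContinuousLinearMap.coe_pi',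
          ContDiffMapSupportedIn.structureMapCLM_top_apply]
        exact (ContDiff.ftaylorSeries φ.contDiff).fderiv i (by exact_mod_cast WithTop.coe_lt_coe.2 (ENat.natCast_lt_top i)) y
      filter_upwards [h3.prod_inl (𝓝 x)] with z hz using hz z.2
  have hT : HasFTaylorSeriesUpTo ∞ (fun x => (p 0 x).curry0) fun x i => p i x :=
    (hasFTaylorSeriesUpTo_top_iff' le_rfl).2 ⟨fun _ => rfl, hder⟩
  refine ⟨⟨fun x => (p 0 x).curry0, hT.contDiff, fun x hx => ?_⟩, ?_⟩
  · have h4 : p 0 x = 0 := by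
      refine tendsto_nhds_unique (hlimx 0 x) (tendsto_const_nhds.congr' ?_)
      filter_upwards [le_principal_iff.1 hlr]
      rintro _ ⟨φ, rfl⟩
      simp only [ContinuousLinearMap.coe_pi', ContDiffMapSupportedIn.structureMapCLM_top_apply]
      exact (φ.iteratedFDeriv_zero_on_compl hx).symm
    simp [h4, ContinuousMultilinearMap.curry0]
  · ext i x : 2
    simp only [ContinuousLinearMap.coe_pi', ContDiffMapSupportedIn.structureMapCLM_top_apply]
    exact (hT.eq_iteratedFDeriv (by exact_mod_cast le_top) x).symm

end General


/-! ### Weakly smooth maps into `𝓓_K` are jointly smooth -/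

section WeaklySmooth

variable {G E : Type*} [NormedAddCommGroup G] [NormedSpace ℝ G]
  [NormedAddCommGroup E] [NormedSpace ℝ E] {K : Compacts E} {U : Set G}

/-- `f : G → 𝓓_K` is smooth on `U` when tested by continuous linear functionals. -/
def WeaklySmoothOn (f : G → 𝓓_{K}(E, ℝ)) (U : Set G) : Prop :=
  ∀ l : 𝓓_{K}(E, ℝ) →L[ℝ] ℝ, ContDiffOn ℝ ∞ (fun u => l (f u)) U

theorem WeaklySmoothOn.add {f g : G → 𝓓_{K}(E, ℝ)} (hf : WeaklySmoothOn f U)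
    (hg : WeaklySmoothOn g U) : WeaklySmoothOn (fun u => f u + g u) U := fun l => by
  simpa only [map_add] using (hf l).add (hg l)

theorem WeaklySmoothOn.clm_comp {f : G → 𝓓_{K}(E, ℝ)} (hf : WeaklySmoothOn f U)
    (A : 𝓓_{K}(E, ℝ) →L[ℝ] 𝓓_{K}(E, ℝ)) : WeaklySmoothOn (fun u => A (f u)) U :=
  fun l => hf (l ∘L A)

theorem WeaklySmoothOn.comp_structureMapCLM {f : G → 𝓓_{K}(E, ℝ)} (hf : WeaklySmoothOn f U)
    (i : ℕ) (l : BoundedContinuousFunction E (E [×i]→L[ℝ] ℝ) →L[ℝ] ℝ) :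
    ContDiffOn ℝ ∞ (fun u => l (ContDiffMapSupportedIn.structureMapCLM ℝ ⊤ i (f u))) U :=
  hf (l ∘L (ContDiffMapSupportedIn.structureMapCLM ℝ ⊤ i :
    𝓓_{K}(E, ℝ) →L[ℝ] BoundedContinuousFunction E (E [×i]→L[ℝ] ℝ)))

theorem WeaklySmoothOn.continuousAt [ProperSpace G] {f : G → 𝓓_{K}(E, ℝ)}
    (hf : WeaklySmoothOn f U) (hU : IsOpen U) {u : G} (hu : u ∈ U) : ContinuousAt f u := by
  rw [(ContDiffMapSupportedIn.isUniformEmbedding_pi_structureMapCLM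
    ℝ).isUniformInducing.isInducing.continuousAt_iff]
  refine continuousAt_pi.2 fun i => ?_
  exact continuousAt_of_weakly_contDiffOn
    (f := fun u => ContDiffMapSupportedIn.structureMapCLM ℝ ⊤ i (f u)) hU
    (hf.comp_structureMapCLM i) hu

theorem fderiv_apply_eq_of_tendsto_slope {F : Type*} [NormedAddCommGroup F] [NormedSpace ℝ F]
    {φ : G → F} {u h : G} {a : F}
    (hφ : DifferentiableAt ℝ φ u)
    (ha : Tendsto (fun t : ℝ => t⁻¹ • (φ (u + t • h) - φ u)) (𝓝[≠] 0) (𝓝 a)) :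
    fderiv ℝ φ u h = a :=
  tendsto_nhds_unique (hφ.hasFDerivAt.hasLineDerivAt h).tendsto_slope_zero ha

/-- The weak directional derivatives of a weakly smooth map are test functions. -/
theorem WeaklySmoothOn.exists_deriv [ProperSpace G] {f : G → 𝓓_{K}(E, ℝ)}
    (hf : WeaklySmoothOn f U) (hU : IsOpen U) {u : G} (hu : u ∈ U) (h : G) :
    ∃ φ, ∀ l : 𝓓_{K}(E, ℝ) →L[ℝ] ℝ, fderiv ℝ (fun u => l (f u)) u h = l φ := by
  have h1 := fun i => exists_tendsto_slope_of_weakly_contDiffOn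
    (f := fun u => ContDiffMapSupportedIn.structureMapCLM ℝ ⊤ i (f u)) hU
    (hf.comp_structureMapCLM i) hu h
  choose a ha using h1
  have hind := (ContDiffMapSupportedIn.isUniformEmbedding_pi_structureMapCLM
    (E := E) (F := ℝ) (n := ⊤) (K := K) ℝ).isUniformInducing.isInducing
  have ha' : Tendsto (fun t : ℝ => ContinuousLinearMap.pi
      (ContDiffMapSupportedIn.structureMapCLM ℝ (E := E) (F := ℝ) (K := K) ⊤)
      (t⁻¹ • (f (u + t • h) - f u))) (𝓝[≠] 0) (𝓝 a) := by
    refine tendsto_pi_nhds.2 fun i => ?_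
    refine (ha i).congr fun t => ?_
    let S : 𝓓_{K}(E, ℝ) →L[ℝ] BoundedContinuousFunction E (E [×i]→L[ℝ] ℝ) :=
      ContDiffMapSupportedIn.structureMapCLM ℝ ⊤ i
    exact ((map_smul S _ _).trans (congrArg _ (map_sub S _ _))).symm
  -- The limits at the separate orders fit together into one test function, as the range is closed.
  obtain ⟨φ, rfl⟩ := (isClosed_range_pi_structureMapCLM K).mem_of_tendsto ha'
    (Eventually.of_forall fun t => mem_range_self _)
  have hφ : Tendsto (fun t : ℝ => t⁻¹ • (f (u + t • h) - f u)) (𝓝[≠] 0) (𝓝 φ) :=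
    hind.tendsto_nhds_iff.2 ha'
  refine ⟨φ, fun l => fderiv_apply_eq_of_tendsto_slope
    (((hf l).contDiffAt (hU.mem_nhds hu)).differentiableAt (by simp)) ?_⟩
  refine ((l.continuous.tendsto φ).comp hφ).congr fun t => ?_
  rw [comp_apply, map_smul, map_sub]

/-- Tested by `l`, the chosen derivative is the directional derivative of `l ∘ f`, which is smooth
on `U`. Values outside `U` are irrelevant. -/
theorem WeaklySmoothOn.exists_deriv_map [ProperSpace G] {f : G → 𝓓_{K}(E, ℝ)}
    (hf : WeaklySmoothOn f U) (hU : IsOpen U) :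
    ∃ f' : G → G → 𝓓_{K}(E, ℝ), (∀ h, WeaklySmoothOn (fun u => f' u h) U) ∧
      ∀ u ∈ U, ∀ h, ∀ l : 𝓓_{K}(E, ℝ) →L[ℝ] ℝ,
        fderiv ℝ (fun u => l (f u)) u h = l (f' u h) := by
  have h1 : ∀ (u h : G), ∃ φ, u ∈ U → ∀ l : 𝓓_{K}(E, ℝ) →L[ℝ] ℝ,
      fderiv ℝ (fun u => l (f u)) u h = l φ := fun u h => by
    by_cases hu : u ∈ U
    · exact (hf.exists_deriv hU hu h).imp fun _ hφ _ => hφ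
    · exact ⟨0, fun h => (hu h).elim⟩
  choose f' hf' using h1
  refine ⟨f', fun h l => ?_, fun u hu h => hf' u h hu⟩
  have h2 : ContDiffOn ℝ ∞ (fderiv ℝ fun u => l (f u)) U := (hf l).fderiv_of_isOpen hU (by simp)
  exact (h2.clm_apply contDiffOn_const).congr fun u hu => (hf' u h hu l).symm

/-- Evaluation at a point. -/
noncomputable def evalCLM (K : Compacts E) (x : E) : 𝓓_{K}(E, ℝ) →L[ℝ] ℝ where
  toFun φ := φ x
  map_add' _ _ := rfl
  map_smul' _ _ := rfl
  cont := continuous_eval_const x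

/-- The directional derivative of test functions. -/
noncomputable def dirDerivCLM (K : Compacts E) (v : E) : 𝓓_{K}(E, ℝ) →L[ℝ] 𝓓_{K}(E, ℝ) :=
  ContDiffMapSupportedIn.postcompCLM (ContinuousLinearMap.apply ℝ ℝ v) ∘L
    ContDiffMapSupportedIn.fderivCLM ℝ ⊤ ⊤

theorem dirDerivCLM_apply (v : E) (φ : 𝓓_{K}(E, ℝ)) (x : E) :
    dirDerivCLM K v φ x = fderiv ℝ φ x v := by
  simp [dirDerivCLM, ContDiffMapSupportedIn.postcompCLM_apply]

/-- Continuous partial derivatives suffice. Here they are evaluations of continuous maps into test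
function spaces, and evaluation is jointly continuous. -/
theorem WeaklySmoothOn.hasFDerivAt_uncurry [FiniteDimensional ℝ G]
    {f : G → 𝓓_{K}(E, ℝ)} (hf : WeaklySmoothOn f U) (hU : IsOpen U)
    {f' : G → G → 𝓓_{K}(E, ℝ)} (hf's : ∀ h, WeaklySmoothOn (fun u => f' u h) U)
    (hf' : ∀ u ∈ U, ∀ h, ∀ l : 𝓓_{K}(E, ℝ) →L[ℝ] ℝ,
      fderiv ℝ (fun u => l (f u)) u h = l (f' u h))
    {p : G × E} (hp : p.1 ∈ U) :
    HasFDerivAt (fun p : G × E => f p.1 p.2)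
      ((fderiv ℝ (fun u => f u p.2) p.1).coprod (fderiv ℝ (f p.1) p.2)) p := by
  have := FiniteDimensional.proper ℝ G
  have hev : ∀ᶠ v : G × E in 𝓝 p, v.1 ∈ U := continuousAt_fst.preimage_mem_nhds (hU.mem_nhds hp)
  refine (hasStrictFDerivAt_uncurry_coprod (𝕜 := ℝ) (f := fun u x => f u x)
    (f₁ := fun u x => fderiv ℝ (fun u => f u x) u) (f₂ := fun u x => fderiv ℝ (f u) x)
    ?_ ?_ ?_ ?_).hasFDerivAt
  · filter_upwards [hev] with v hv
    exact (((hf (evalCLM K v.2)).contDiffAt (hU.mem_nhds hv)).differentiableAt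
      (by simp)).hasFDerivAt
  · exact Eventually.of_forall fun v =>
      ((f v.1).contDiff.differentiable (by simp) v.2).hasFDerivAt
  · refine continuousAt_clm_apply.2 fun h => ?_
    have h1 : ContinuousAt (fun v : G × E => f' v.1 h v.2) p :=
      ContinuousAt.eval (((hf's h).continuousAt hU hp).comp continuousAt_fst) continuousAt_snd
    refine h1.congr ?_
    filter_upwards [hev] with v hv
    exact (hf' v.1 hv h (evalCLM K v.2)).symm
  · have h2 : ContinuousAt (fun v : G × E =>
        (ContDiffMapSupportedIn.fderivCLM ℝ (K := K) (F := ℝ) ⊤ ⊤ (f v.1) : _) v.2) p :=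
      ContinuousAt.eval ((ContinuousLinearMap.continuous _).continuousAt.comp
        ((hf.continuousAt hU hp).comp continuousAt_fst)) continuousAt_snd
    refine h2.congr (Eventually.of_forall fun v => ?_)
    simp [HasUncurry.uncurry]

/-- Weakly smooth maps into `𝓓_K` are jointly smooth. -/
theorem WeaklySmoothOn.contDiffOn_uncurry [FiniteDimensional ℝ G] [FiniteDimensional ℝ E]
    {f : G → 𝓓_{K}(E, ℝ)} (hf : WeaklySmoothOn f U) (hU : IsOpen U) :
    ContDiffOn ℝ ∞ (fun p : G × E => f p.1 p.2) (U ×ˢ univ) := by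
  have := FiniteDimensional.proper ℝ G
  have hs : IsOpen (U ×ˢ (univ : Set E)) := hU.prod isOpen_univ
  refine contDiffOn_infty_of_stable hs
    (P := fun g => ∃ f : G → 𝓓_{K}(E, ℝ), WeaklySmoothOn f U ∧
      ∀ p ∈ U ×ˢ (univ : Set E), g p = f p.1 p.2) ?_ ?_ ⟨f, hf, fun _ _ => rfl⟩
  · rintro g ⟨f, hf, hg⟩ p hp
    obtain ⟨f', hf's, hf'⟩ := hf.exists_deriv_map hU
    refine DifferentiableAt.differentiableWithinAt ?_
    exact ((hf.hasFDerivAt_uncurry hU hf's hf' hp.1).congr_of_eventuallyEq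
      (eventuallyEq_of_mem (hs.mem_nhds hp) hg)).differentiableAt
  · rintro g ⟨f, hf, hg⟩ v
    obtain ⟨f', hf's, hf'⟩ := hf.exists_deriv_map hU
    -- The derivative of `f^∨` along `(v.1, v.2)` splits into a derivative in the parameter and one
    -- of the test function itself.
    refine ⟨fun u => f' u v.1 + dirDerivCLM K v.2 (f u), (hf's v.1).add (hf.clm_comp _),
      fun p hp => ?_⟩
    beta_reduce
    rw [((hf.hasFDerivAt_uncurry hU hf's hf' hp.1).congr_of_eventuallyEq
      (eventuallyEq_of_mem (hs.mem_nhds hp) hg)).fderiv, ContinuousLinearMap.coprod_apply,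
      ← dirDerivCLM_apply]
    exact congrArg (· + _) (hf' p.1 hp.1 v.1 (evalCLM K p.2))

end WeaklySmooth


/-! ### Jointly smooth functions as smooth maps into `C(K, Y)` -/

section JointlySmooth

variable {G E Y : Type*} [NormedAddCommGroup G] [NormedSpace ℝ G]
  [NormedAddCommGroup E] [NormedSpace ℝ E] [NormedAddCommGroup Y] [NormedSpace ℝ Y] {U : Set G}

theorem hasFDerivAt_fst_of_contDiffOn {g : G × E → Y} (hU : IsOpen U)
    (hg : ContDiffOn ℝ ∞ g (U ×ˢ univ)) {u : G} (hu : u ∈ U) (x : E) :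
    HasFDerivAt (fun u => g (u, x)) (fderiv ℝ g (u, x) ∘L .inl ℝ G E) u :=
  (((hg.contDiffAt ((hU.prod isOpen_univ).mem_nhds ⟨hu, mem_univ x⟩)).differentiableAt
    (by simp)).hasFDerivAt).comp u (hasFDerivAt_prodMk_left u x)

/-- A jointly smooth function defines a differentiable map into `C(K, Y)` for compact `K`, the
derivative being taken pointwise. -/
theorem exists_hasFDerivAt_continuousMap [FiniteDimensional ℝ G] {K : Set E} [CompactSpace K]
    {g : G × E → Y} (hU : IsOpen U) (hg : ContDiffOn ℝ ∞ g (U ×ˢ univ)) {F : G → C(K, Y)}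
    (hF : ∀ u ∈ U, ∀ x : K, F u x = g (u, x)) {u : G} (hu : u ∈ U) :
    ∃ A : G →L[ℝ] C(K, Y), HasFDerivAt F A u ∧
      ∀ h, ∀ x : K, A h x = fderiv ℝ g (u, (x : E)) (h, 0) := by
  have := FiniteDimensional.proper ℝ G
  have hs : IsOpen (U ×ˢ (univ : Set E)) := hU.prod isOpen_univ
  have hg' : ContinuousOn (fderiv ℝ g) (U ×ˢ univ) :=
    (hg.fderiv_of_isOpen (m := ∞) hs (by simp)).continuousOn
  have hD : ContinuousOn (fun p : G × K => fderiv ℝ g (p.1, (p.2 : E)) ∘L .inl ℝ G E)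
      (U ×ˢ univ) := by
    refine ContinuousOn.clm_comp (hg'.comp (by fun_prop) fun p hp => ⟨hp.1, mem_univ _⟩)
      continuousOn_const
  have hDu : Continuous fun x : K => fderiv ℝ g (u, (x : E)) ∘L .inl ℝ G E :=
    continuousOn_univ.1 (hD.comp (f := fun x : K => (u, x)) (by fun_prop)
      fun x _ => ⟨hu, mem_univ _⟩)
  let A₀ : G →ₗ[ℝ] C(K, Y) :=
    { toFun h := ⟨fun x => (fderiv ℝ g (u, (x : E)) ∘L .inl ℝ G E) h,
        hDu.clm_apply continuous_const⟩
      map_add' a b := by ext x; exact (fderiv ℝ g (u, (x : E)) ∘L .inl ℝ G E).map_add a b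
      map_smul' c a := by ext x; exact (fderiv ℝ g (u, (x : E)) ∘L .inl ℝ G E).map_smul c a }
  refine ⟨A₀.toContinuousLinearMap, ?_, fun h x => rfl⟩
  rw [hasFDerivAt_iff_isLittleO, Asymptotics.isLittleO_iff]
  intro ε hε
  -- Compactness of `K` makes continuity of the partial derivative in the parameter uniform in `x`;
  -- the mean value inequality then gives one `ε`-estimate for all `x`.
  have hunif := Metric.tendstoUniformly_iff.1 (ContinuousOn.tendstoUniformly
    (f := fun (v : G) (x : K) => fderiv ℝ g (v, (x : E)) ∘L .inl ℝ G E) (hU.mem_nhds hu) hD) ε hε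
  obtain ⟨r, hr, hrU⟩ := Metric.mem_nhds_iff.1 (inter_mem hunif (hU.mem_nhds hu))
  filter_upwards [Metric.ball_mem_nhds u hr] with v hv
  rw [ContinuousMap.norm_le _ (by positivity)]
  intro x
  have := (convex_ball u r).norm_image_sub_le_of_norm_hasFDerivWithin_le' (𝕜 := ℝ)
    (f := fun u => g (u, (x : E))) (f' := fun v => fderiv ℝ g (v, (x : E)) ∘L .inl ℝ G E)
    (φ := fderiv ℝ g (u, (x : E)) ∘L .inl ℝ G E) (C := ε)
    (fun w hw => (hasFDerivAt_fst_of_contDiffOn hU hg (hrU hw).2 x).hasFDerivWithinAt)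
    (fun w hw => by
      have := (hrU hw).1 x
      rw [dist_comm, dist_eq_norm] at this
      exact this.le) (Metric.mem_ball_self hr) hv
  simpa only [ContinuousMap.sub_apply, hF v (hrU hv).2, hF u hu] using! this

/-- The maps represented on `U × K` by a jointly smooth `g` form a stable class: the derivative
along `h` is represented by that of `g` along `(h, 0)`. -/
theorem contDiffOn_continuousMap [FiniteDimensional ℝ G] {K : Set E} [CompactSpace K]
    {g : G × E → Y} (hU : IsOpen U) (hg : ContDiffOn ℝ ∞ g (U ×ˢ univ)) {F : G → C(K, Y)}
    (hF : ∀ u ∈ U, ∀ x : K, F u x = g (u, x)) : ContDiffOn ℝ ∞ F U := by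
  have hs : IsOpen (U ×ˢ (univ : Set E)) := hU.prod isOpen_univ
  refine contDiffOn_infty_of_stable hU
    (P := fun F : G → C(K, Y) => ∃ g : G × E → Y, ContDiffOn ℝ ∞ g (U ×ˢ univ) ∧
      ∀ u ∈ U, ∀ x : K, F u x = g (u, x)) ?_ ?_ ⟨g, hg, hF⟩
  · rintro F ⟨g, hg, hF⟩ u hu
    obtain ⟨A, hA, -⟩ := exists_hasFDerivAt_continuousMap hU hg hF hu
    exact hA.differentiableAt.differentiableWithinAt
  · rintro F ⟨g, hg, hF⟩ h
    refine ⟨fun p => fderiv ℝ g p (h, 0),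
      (hg.fderiv_of_isOpen hs (by simp)).clm_apply contDiffOn_const, fun u hu x => ?_⟩
    obtain ⟨A, hA, hA'⟩ := exists_hasFDerivAt_continuousMap hU hg hF hu
    beta_reduce
    rw [hA.fderiv, hA']

/-- The partial derivatives in the second variable of a jointly smooth function are jointly
smooth. -/
theorem contDiffOn_iteratedFDeriv_snd {g : G → E → Y} (hU : IsOpen U)
    (hg : ContDiffOn ℝ ∞ (fun p : G × E => g p.1 p.2) (U ×ˢ univ)) (k : ℕ) :
    ContDiffOn ℝ ∞ (fun p : G × E => iteratedFDeriv ℝ k (g p.1) p.2) (U ×ˢ univ) := by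
  have hs : IsOpen (U ×ˢ (univ : Set E)) := hU.prod isOpen_univ
  induction k with
  | zero =>
    simp only [iteratedFDeriv_zero_eq_comp, comp_apply]
    exact (continuousMultilinearCurryFin0 ℝ E Y).symm.contDiff.comp_contDiffOn hg
  | succ k ih =>
    simp only [iteratedFDeriv_succ_eq_comp_left, comp_apply]
    have h : ContDiffOn ℝ ∞ (fun p : G × E => fderiv ℝ (iteratedFDeriv ℝ k (g p.1)) p.2)
        (U ×ˢ univ) := by
      refine fun p hp => ContDiffAt.contDiffWithinAt ?_
      refine ContDiffAt.fderiv (n := ∞) (f := fun (p : G × E) y => iteratedFDeriv ℝ k (g p.1) y)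
        (g := Prod.snd) ?_ contDiffAt_snd (by simp)
      exact ContDiffAt.comp (p, p.2) (g := fun p : G × E => iteratedFDeriv ℝ k (g p.1) p.2)
        (f := fun q : (G × E) × E => (q.1.1, q.2))
        (ih.contDiffAt (hs.mem_nhds ⟨hp.1, mem_univ _⟩)) (by fun_prop)
    exact h.continuousLinearMap_comp
        ((continuousMultilinearCurryLeftEquiv ℝ (fun _ : Fin (k + 1) => E) Y).symm :
          (E →L[ℝ] E [×k]→L[ℝ] Y) →L[ℝ] E [×(k + 1)]→L[ℝ] Y)

end JointlySmooth

/-! ### Continuous functionals on `𝓓_K`, and joint smoothness implies weak smoothness -/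

section Factorization

variable {E : Type*} [NormedAddCommGroup E] [NormedSpace ℝ E] {K : Compacts E}

/-- A linear functional bounded by the norm of a linear map factors through that map. -/
theorem exists_clm_factorization {V X : Type*} [AddCommGroup V] [Module ℝ V]
    [NormedAddCommGroup X] [NormedSpace ℝ X] (l : V →ₗ[ℝ] ℝ) (T : V →ₗ[ℝ] X) (C : ℝ)
    (h : ∀ φ, ‖l φ‖ ≤ C * ‖T φ‖) : ∃ L : X →L[ℝ] ℝ, ∀ φ, L (T φ) = l φ := by
  obtain ⟨s, hs⟩ := T.rangeRestrict.exists_rightInverse_of_surjective T.range_rangeRestrict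
  have hs' : ∀ y, T (s y) = y := fun y => congrArg Subtype.val (LinearMap.congr_fun hs y)
  obtain ⟨L, hL, -⟩ := exists_extension_norm_eq (𝕜 := ℝ) T.range
    ((l ∘ₗ s).mkContinuous C fun y => (h (s y)).trans_eq (by rw [hs']; rfl))
  refine ⟨L, fun φ => ?_⟩
  have h1 : L (T φ) = l (s (T.rangeRestrict φ)) := hL (T.rangeRestrict φ)
  -- The bound forces `l` to vanish on the kernel of `T`, so the choice of section `s` is harmless.
  rw [h1, ← sub_eq_zero, ← map_sub, ← norm_le_zero_iff]
  refine (h _).trans_eq ?_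
  rw [map_sub, hs']
  simp

/-- The restriction to `K` of the `i`-th derivative of test functions. -/
noncomputable def derivOnK (K : Compacts E) (i : ℕ) :
    𝓓_{K}(E, ℝ) →ₗ[ℝ] C((K : Set E), E [×i]→L[ℝ] ℝ) where
  toFun φ := ⟨fun x => ContDiffMapSupportedIn.structureMapLM ℝ ⊤ i φ x, by fun_prop⟩
  map_add' φ ψ := by ext; simp
  map_smul' c φ := by ext; simp

theorem derivOnK_apply (i : ℕ) (φ : 𝓓_{K}(E, ℝ)) (x : (K : Set E)) :
    derivOnK K i φ x = iteratedFDeriv ℝ i φ x := by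
  simp [derivOnK, ContDiffMapSupportedIn.structureMapLM_top_apply]

instance compactSpace_coe_compacts : CompactSpace (K : Set E) :=
  isCompact_iff_compactSpace.1 K.isCompact

/-- A continuous linear functional on `𝓓_K` factors through finitely many derivatives. -/
theorem exists_factorization (l : 𝓓_{K}(E, ℝ) →L[ℝ] ℝ) :
    ∃ (s : Finset ℕ) (L : (∀ i : s, C((K : Set E), E [×i]→L[ℝ] ℝ)) →L[ℝ] ℝ),
      ∀ φ, l φ = L fun i => derivOnK K i φ := by
  obtain ⟨s, C, -, hC⟩ := Seminorm.bound_of_continuous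
    (ContDiffMapSupportedIn.withSeminorms ℝ E ℝ ⊤ K) ((normSeminorm ℝ ℝ).comp l.toLinearMap)
    (by exact continuous_norm.comp l.continuous)
  let T : 𝓓_{K}(E, ℝ) →ₗ[ℝ] ∀ i : s, C((K : Set E), E [×i]→L[ℝ] ℝ) :=
    LinearMap.pi fun i : s => derivOnK K i
  have hT : ∀ φ, ‖l φ‖ ≤ C * ‖T φ‖ := by
    intro φ
    refine (hC φ).trans ?_
    rw [smul_apply, NNReal.smul_def, smul_eq_mul]
    gcongr
    refine Seminorm.finset_sup_apply_le (norm_nonneg _) fun i hi => ?_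
    rw [ContDiffMapSupportedIn.seminorm_top_le_iff ℝ (norm_nonneg _)]
    intro x hx
    rw [← derivOnK_apply i φ ⟨x, hx⟩]
    exact (ContinuousMap.norm_coe_le_norm _ _).trans (norm_le_pi_norm (T φ) ⟨i, hi⟩)
  obtain ⟨L, hL⟩ := exists_clm_factorization
    (X := ∀ i : s, C((K : Set E), E [×i]→L[ℝ] ℝ)) l.toLinearMap T C hT
  exact ⟨s, L, fun φ => (hL φ).symm⟩

/-- Jointly smooth maps into `𝓓_K` are weakly smooth. -/
theorem weaklySmoothOn_of_contDiffOn {G : Type*} [NormedAddCommGroup G] [NormedSpace ℝ G]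
    [FiniteDimensional ℝ G] {U : Set G} (hU : IsOpen U) {f : G → 𝓓_{K}(E, ℝ)}
    (hf : ContDiffOn ℝ ∞ (fun p : G × E => f p.1 p.2) (U ×ˢ univ)) : WeaklySmoothOn f U := by
  intro l
  obtain ⟨s, L, hL⟩ := exists_factorization l
  simp only [hL]
  have h : ContDiffOn ℝ ∞ (fun u => fun i : s => derivOnK K i (f u)) U :=
    contDiffOn_pi.2 fun i => contDiffOn_continuousMap hU (contDiffOn_iteratedFDeriv_snd
      (g := fun u => f u) hU hf i)
      fun u _ x => derivOnK_apply i (f u) x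
  exact h.continuousLinearMap_comp L

end Factorization


/-! ### Transfer from `ℝⁿ` to `Ω` -/

section PlotsOfDK

variable {m n : ℕ} {Ω : Opens (Eucl n)} {K : Compacts Ω} {U : Opens (Eucl m)}

theorem eq_zero_of_notMem (φ : 𝓓_{ambient K}(Eucl n, ℝ)) {x : Eucl n} (hx : x ∉ Ω) : φ x = 0 := by
  refine φ.zero_on_compl ?_
  rintro ⟨y, -, rfl⟩
  exact hx y.2

/-- Restriction to `Ω`, the inverse of extension by zero. -/
noncomputable def restrictToOpen (Ω : Opens (Eucl n)) (K : Compacts Ω) :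
    𝓓_{ambient K}(Eucl n, ℝ) →ₗ[ℝ] DK Ω K where
  toFun φ := ⟨⟨fun x => φ x, isSmooth_of_contDiffOn φ.contDiff.contDiffOn fun _ => rfl⟩, by
    refine closure_minimal (fun x hx => ?_) K.isCompact.isClosed
    by_contra hxK
    refine hx (φ.zero_on_compl ?_)
    rintro ⟨y, hy, hyx⟩
    exact hxK (Subtype.ext hyx ▸ hy)⟩
  map_add' _ _ := rfl
  map_smul' _ _ := rfl

theorem extendByZero_apply (φ : DK Ω K) (x : Ω) : extendByZero Ω K φ x = (φ.1 : Ω → ℝ) x :=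
  extend_val _ x.2

theorem extendByZero_restrictToOpen (φ : 𝓓_{ambient K}(Eucl n, ℝ)) :
    extendByZero Ω K (restrictToOpen Ω K φ) = φ := by
  ext x
  by_cases hx : x ∈ Ω
  · exact extendByZero_apply _ ⟨x, hx⟩
  · rw [eq_zero_of_notMem _ hx, eq_zero_of_notMem _ hx]

theorem restrictToOpen_extendByZero (φ : DK Ω K) :
    restrictToOpen Ω K (extendByZero Ω K φ) = φ :=
  Subtype.ext (Subtype.ext (funext fun x => extendByZero_apply φ x))

/-- A map `U → 𝒟_K(Ω)` as a map from the ambient space, extending its values by zero. -/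
noncomputable def ambientMap (f : U → DK Ω K) : Eucl m → 𝓓_{ambient K}(Eucl n, ℝ) :=
  Function.extend Subtype.val (fun u => extendByZero Ω K (f u)) 0

theorem ambientMap_apply (f : U → DK Ω K) (u : U) : ambientMap f u = extendByZero Ω K (f u) :=
  Subtype.val_injective.extend_apply _ _ u

/-- Extension by zero and restriction are mutually inverse and continuous, so the functionals on the
two spaces correspond. -/
theorem isPlot_diffeologyDK_iff (f : U → DK Ω K) :
    (diffeologyDK Ω K).IsPlot f ↔ WeaklySmoothOn (ambientMap f) (U : Set (Eucl m)) := by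
  let _ := frechetTopology Ω K
  constructor
  · intro hf l
    have h1 := hf (l ∘L ⟨extendByZero Ω K, continuous_induced_dom⟩)
    refine ContDiffOn.congr h1 fun u hu => ?_
    rw [extend_val _ hu]
    exact congrArg l (ambientMap_apply f ⟨u, hu⟩)
  · intro hf l
    have hc : Continuous (restrictToOpen Ω K) := by
      refine continuous_induced_rng.2 ?_
      simpa only [comp_def, extendByZero_restrictToOpen] using continuous_id'
    refine isSmooth_of_contDiffOn (hf (l ∘L ⟨restrictToOpen Ω K, hc⟩)) fun u => ?_
    rw [ambientMap_apply]
    exact congrArg l (restrictToOpen_extendByZero (f u)).symm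

/-- A point outside `Ω` has a neighbourhood missing the compact set `ambient K`, and there the
extended function is zero. -/
theorem isSmooth_vee_iff (f : U → DK Ω K) :
    IsSmooth (vee fun u => ((f u).1 : Ω → ℝ)) ↔
      ContDiffOn ℝ ∞ (fun p : Eucl m × Eucl n => ambientMap f p.1 p.2)
        ((U : Set (Eucl m)) ×ˢ univ) := by
  have heq : ∀ p : prodOpens U Ω, vee (fun u => ((f u).1 : Ω → ℝ)) p =
      ambientMap f (p : Eucl m × Eucl n).1 (p : Eucl m × Eucl n).2 := by
    rintro ⟨⟨u, x⟩, hu, hx⟩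
    rw [ambientMap_apply f ⟨u, hu⟩]
    exact (extendByZero_apply (f ⟨u, hu⟩) ⟨x, hx⟩).symm
  constructor
  · rintro hf ⟨u, x⟩ ⟨hu, -⟩
    refine ContDiffAt.contDiffWithinAt ?_
    by_cases hx : x ∈ Ω
    · have hn : (prodOpens U Ω : Set (Eucl m × Eucl n)) ∈ 𝓝 (u, x) :=
        (prodOpens U Ω).isOpen.mem_nhds ⟨hu, hx⟩
      refine (ContDiffOn.contDiffAt hf hn).congr_of_eventuallyEq ?_
      filter_upwards [hn] with p hp
      rw [extend_val _ hp, heq]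
    · have hxK : x ∉ ambient K := by
        rintro ⟨y, -, rfl⟩
        exact hx y.2
      refine (contDiffAt_const (c := (0 : ℝ))).congr_of_eventuallyEq ?_
      have hn : {p : Eucl m × Eucl n | p.2 ∉ ambient K} ∈ 𝓝 (u, x) :=
        continuousAt_snd.preimage_mem_nhds (t := (ambient K : Set (Eucl n))ᶜ)
          ((ambient K).isCompact.isClosed.isOpen_compl.mem_nhds hxK)
      filter_upwards [hn] with p hp
      exact (ambientMap f p.1).zero_on_compl hp
  · intro hf
    exact isSmooth_of_contDiffOn (hf.mono fun p hp => ⟨hp.1, mem_univ _⟩) heq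

theorem isPlot_diffeologyDK_iff_isSmooth_vee (f : U → DK Ω K) :
    (diffeologyDK Ω K).IsPlot f ↔ IsSmooth (vee fun u => ((f u).1 : Ω → ℝ)) := by
  rw [isPlot_diffeologyDK_iff, isSmooth_vee_iff]
  exact ⟨fun h => h.contDiffOn_uncurry U.isOpen, weaklySmoothOn_of_contDiffOn U.isOpen⟩

/-- Plots are the smooth maps from open subsets of Euclidean spaces. -/
theorem diffSmooth_standardDiffeology_iff {X : Type*} (D : FigDiffeology X) (f : U → X) :
    DiffSmooth (standardDiffeology U) D f ↔ D.IsPlot f :=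
  ⟨fun h => h id (isSmooth_of_contDiffOn (g := id) contDiffOn_id fun _ => rfl),
    fun h _ _ d hd => D.reparam d h hd⟩

theorem isSmooth_of_isSmooth_vee {g : U → Ω → ℝ} (hg : IsSmooth (vee g)) (u : U) :
    IsSmooth (g u) :=
  IsSmooth.comp (V := Ω) (U := prodOpens U Ω) (f := vee g) hg
    (g := fun x => ⟨((u : Eucl m), (x : Eucl n)), u.2, x.2⟩)
    (isSmooth_of_contDiffOn (g := fun x => ((u : Eucl m), x)) (by fun_prop) fun _ => rfl)

end PlotsOfDK

end FigDiffeo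

open FigDiffeo
theorem mainTheorem7 (n : ℕ) (Ω : Opens (Eucl n))
    (K : Compacts Ω) :
    -- characterization of the plots among the maps into `𝒟_K(Ω)`
    (∀ (m : ℕ) (U : Opens (Eucl m)) (f : U → DK Ω K),
      List.TFAE
        [(diffeologyDK Ω K).IsPlot f,
          DiffSmooth (standardDiffeology U) (diffeologyDK Ω K) f,
          IsSmooth (vee fun u => ((f u).1 : Ω → ℝ)) ∧
            ∀ u, tsupport ((f u).1 : Ω → ℝ) ⊆ (K : Set Ω)]) ∧
    -- the same for an arbitrary function on `U × Ω`
    (∀ (m : ℕ) (U : Opens (Eucl m)) (g : U → Ω → ℝ),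
      (∃ f : U → DK Ω K, (∀ u, ((f u).1 : Ω → ℝ) = g u) ∧
          DiffSmooth (standardDiffeology U) (diffeologyDK Ω K) f) ↔
        (IsSmooth (vee g) ∧ ∀ u, tsupport (g u) ⊆ (K : Set Ω))) ∧
    -- the canonical diffeology is the sub-diffeology from `C^∞(Ω, ℝ)`
    diffeologyDK Ω K = subDiffeologyDK Ω K := by
  refine ⟨fun m U f => ?_, fun m U g => ⟨?_, ?_⟩, ?_⟩
  · tfae_have 1 ↔ 2 := (diffSmooth_standardDiffeology_iff _ f).symm
    tfae_have 1 ↔ 3 := by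
      rw [isPlot_diffeologyDK_iff_isSmooth_vee]
      exact ⟨fun h => ⟨h, fun u => (f u).2⟩, fun h => h.1⟩
    tfae_finish
  · rintro ⟨f, hfg, hf⟩
    obtain rfl : (fun u => ((f u).1 : Ω → ℝ)) = g := funext hfg
    rw [diffSmooth_standardDiffeology_iff, isPlot_diffeologyDK_iff_isSmooth_vee] at hf
    exact ⟨hf, fun u => (f u).2⟩
  · rintro ⟨hg, hK⟩
    refine ⟨fun u => ⟨⟨g u, isSmooth_of_isSmooth_vee hg u⟩, hK u⟩, fun _ => rfl, ?_⟩
    rw [diffSmooth_standardDiffeology_iff, isPlot_diffeologyDK_iff_isSmooth_vee]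
    exact hg
  · ext m U f
    exact isPlot_diffeologyDK_iff_isSmooth_vee f
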